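/- **Theorem.** For $A\in\mathbb R^{3\times 3}$ let $\mathrm{sk}(A)=(A-A^\top)/2$; let $\hat w$ be the skew-symmetric matrix with $\hat w v=w\times v$, let ${}^\vee$ be the inverse of $w\mapsto\hat w$, and $e_3=(0,0,1)^\top$. Fix a constant $R_r\in SO(3)$ and a gain $k_s>0$, and put $d_r=R_re_3$. The human operator is a time-invariant system $\dot x=f(x,u)$, $\omega_h^b=g(x,u)$ with internal state $x\in\mathbb R^n$ and continuous $f,g$, input $u=\mathrm{sk}(R_l^\top R_r)^\vee$ and command $\omega_h^s=R_l\,\omega_h^b$. Consider the closed loop for $(\bar R,R_l,x)\in SO(3)\times SO(3)\times\mathbb R^n$, $$\dot{\bar R}=\hat{\tilde\omega}_h^s\bar R,\qquad \tilde\omega_h^s=k_s\bar R\,\mathrm{sk}(\bar R^\top R_l)^\vee,$$ $$\dot R_l=R_l\hat\omega_l,\qquad \omega_l=k_s\,\mathrm{sk}(R_l^\top\bar R)^\vee+R_l^\top\omega_h^s,\qquad \dot x=f\big(x,\mathrm{sk}(R_l^\top R_r)^\vee\big),$$ and put $\bar d=\bar Re_3$, $d_l=R_le_3$, $R_{rl}=R_r^\top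 R_l$, $\bar R_r=R_r^\top\bar R$. Let $(\bar R,R_l,x)$ be a trajectory on $[0,\infty)$, and assume: 1. $R_{rl}(t)+R_{rl}(t)^\top$ is positive definite for all $t\ge 0$; 2. the operator identically sends zero only if $d_l=d_r$ identically: for every trajectory of the closed loop on $[0,\infty)$ along which $R_{rl}+R_{rl}^\top$ is positive semidefinite, if $\omega_h^s(t)=0$ for all $t\ge0$ then $d_l(t)=d_r$ for all $t\ge0$; 3. along the given trajectory, if the input $\mathrm{sk}(R_l^\top R_r)^\vee$ is bounded on $[0,\infty)$, then so are $\omega_h^s$ and $x$; 4. (passivity) there is $\beta\ge0$ such that along the given trajectory $\int_0^\tau\{\mathrm{sk}(R_l^\top R_r)^\vee\}^\top\omega_h^b\,dt\ge-\beta$ for all $\tau\ge0$. If $\bar R_r(0)+\bar R_r(0)^\top$ is positive semidefinite, then $\bar d(t)\to d_r$ and $d_l(t)\to d_r$ as $t\to\infty$. -/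

import Mathlib

open Matrix Set Filter Topology

namespace SemiAutonomous

/-- Vectors of `ℝ³`. -/
abbrev Vec3 := Fin 3 → ℝ

/-- Real `3 × 3` matrices. -/
abbrev Mat3 := Matrix (Fin 3) (Fin 3) ℝ

/-- The hat map: `hat w` is the skew-symmetric matrix with `hat w *ᵥ v = w × v`. -/
def hat (w : Vec3) : Mat3 :=
  !![0, -w 2, w 1;
     w 2, 0, -w 0;
     -w 1, w 0, 0]

/-- The vee map, the inverse of the hat map on skew-symmetric matrices. -/
def vee (A : Mat3) : Vec3 := ![A 2 1, A 0 2, A 1 0]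

theorem hat_mulVec (w v : Vec3) : hat w *ᵥ v = crossProduct w v := by
  ext i
  fin_cases i <;> simp [hat, cross_apply, Matrix.mulVec, dotProduct, Fin.sum_univ_three] <;> ring

theorem vee_hat (w : Vec3) : vee (hat w) = w := by
  ext i
  fin_cases i <;> simp [hat, vee]

/-- The skew-symmetric part `sk(A) = (A - Aᵀ) / 2`. -/
noncomputable def sk (A : Mat3) : Mat3 := (1 / 2 : ℝ) • (A - Aᵀ)

theorem hat_vee_sk (A : Mat3) : hat (vee (sk A)) = sk A := by
  ext i j
  fin_cases i <;> fin_cases j <;> simp [hat, vee, sk] <;> ring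

/-- `R ∈ SO(3)`. -/
def IsRotation (R : Mat3) : Prop := R ∈ Matrix.specialOrthogonalGroup (Fin 3) ℝ

/-- The `z`-axis `R e₃` of an attitude `R`. -/
def zAxis (R : Mat3) : Vec3 := R *ᵥ ![0, 0, 1]

/-- A time-invariant human operator with internal state in `ℝⁿ`: driven by the input `u`,
its state obeys `ẋ = f x u` and its output (the body velocity command) is `g x u`. -/
structure HumanOperator (n : ℕ) where
  /-- state equation -/
  f : EuclideanSpace ℝ (Fin n) → Vec3 → EuclideanSpace ℝ (Fin n)
  /-- output equation -/
  g : EuclideanSpace ℝ (Fin n) → Vec3 → Vec3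
  continuous_f : Continuous (fun p : EuclideanSpace ℝ (Fin n) × Vec3 => f p.1 p.2)
  continuous_g : Continuous (fun p : EuclideanSpace ℝ (Fin n) × Vec3 => g p.1 p.2)

/-- The input `sk(R_lᵀ R_r)^∨` to the human. -/
noncomputable def humanInput (Rr Rl : Mat3) : Vec3 := vee (sk (Rlᵀ * Rr))

/-- The body velocity command `ω_h^b` sent by the human in internal state `x`. -/
noncomputable def commandBody {n : ℕ} (H : HumanOperator n) (Rr Rl : Mat3)
    (x : EuclideanSpace ℝ (Fin n)) : Vec3 := H.g x (humanInput Rr Rl)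

/-- The command `ω_h^s = R_l ω_h^b` in the world frame (equivalently `ω_h^b = R_lᵀ ω_h^s`). -/
noncomputable def commandSpatial {n : ℕ} (H : HumanOperator n) (Rr Rl : Mat3)
    (x : EuclideanSpace ℝ (Fin n)) : Vec3 := Rl *ᵥ commandBody H Rr Rl x

/-- The synchronization law for the average: `ω̃_h^s = k_s R̄ sk(R̄ᵀ R_l)^∨`. -/
noncomputable def averageVelocity (ks : ℝ) (Rbar Rl : Mat3) : Vec3 :=
  ks • (Rbar *ᵥ vee (sk (Rbarᵀ * Rl)))

/-- The synchronization law for the virtual leader: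
`ω_l = k_s sk(R_lᵀ R̄)^∨ + R_lᵀ ω_h^s`, where `w` is the command `ω_h^s`. -/
noncomputable def leaderVelocity (ks : ℝ) (Rbar Rl : Mat3) (w : Vec3) : Vec3 :=
  ks • vee (sk (Rlᵀ * Rbar)) + Rlᵀ *ᵥ w

/-- A trajectory `(R̄, R_l, x)` on `[0, ∞)` of the closed loop formed by the quasi-average
dynamics, the virtual leader, the synchronization law and the human operator
(the derivatives at time `0` are one-sided, those of matrices are taken entrywise). -/
structure IsTrajectory {n : ℕ} (H : HumanOperator n) (ks : ℝ) (Rr : Mat3)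
    (Rbar Rl : ℝ → Mat3) (x : ℝ → EuclideanSpace ℝ (Fin n)) : Prop where
  rotation_avg : ∀ t, 0 ≤ t → IsRotation (Rbar t)
  rotation_leader : ∀ t, 0 ≤ t → IsRotation (Rl t)
  deriv_avg : ∀ t, 0 ≤ t → ∀ i j, HasDerivWithinAt (fun s => Rbar s i j)
    ((hat (averageVelocity ks (Rbar t) (Rl t)) * Rbar t) i j) (Ici 0) t
  deriv_leader : ∀ t, 0 ≤ t → ∀ i j, HasDerivWithinAt (fun s => Rl s i j)
    ((Rl t * hat (leaderVelocity ks (Rbar t) (Rl t)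
      (commandSpatial H Rr (Rl t) (x t)))) i j) (Ici 0) t
  deriv_state : ∀ t, 0 ≤ t →
    HasDerivWithinAt x (H.f (x t) (humanInput Rr (Rl t))) (Ici 0) t

/-- The operator identically sends `ω_h^s = 0` only if `d_l = d_r` identically holds. This is a
property of the operator in the loop, so it concerns every closed-loop motion (not a single one)
along which `R_rl + R_rlᵀ` is positive semidefinite. -/
def ZeroCommandOnlyIfAligned {n : ℕ} (H : HumanOperator n) (ks : ℝ) (Rr : Mat3) : Prop :=
  ∀ (Rbar Rl : ℝ → Mat3) (x : ℝ → EuclideanSpace ℝ (Fin n)),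
    IsTrajectory H ks Rr Rbar Rl x →
    (∀ t, 0 ≤ t → (Rrᵀ * Rl t + (Rrᵀ * Rl t)ᵀ).PosSemidef) →
    (∀ t, 0 ≤ t → commandSpatial H Rr (Rl t) (x t) = 0) →
    ∀ t, 0 ≤ t → zAxis (Rl t) = zAxis Rr

/-- If the input to the human is bounded, then so are the output and the internal state. -/
def BoundedResponse {n : ℕ} (H : HumanOperator n) (Rr : Mat3)
    (Rl : ℝ → Mat3) (x : ℝ → EuclideanSpace ℝ (Fin n)) : Prop :=
  Bornology.IsBounded ((fun t => humanInput Rr (Rl t)) '' Ici 0) →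
    Bornology.IsBounded ((fun t => commandSpatial H Rr (Rl t) (x t)) '' Ici 0) ∧
    Bornology.IsBounded (x '' Ici 0)

/-- Passivity of the human from `sk(R_lᵀ R_r)^∨` to `ω_h^b`. -/
def PassiveResponse {n : ℕ} (H : HumanOperator n) (Rr : Mat3)
    (Rl : ℝ → Mat3) (x : ℝ → EuclideanSpace ℝ (Fin n)) : Prop :=
  ∃ β : ℝ, 0 ≤ β ∧ ∀ τ : ℝ, 0 ≤ τ →
    -β ≤ ∫ t in (0 : ℝ)..τ, humanInput Rr (Rl t) ⬝ᵥ commandBody H Rr (Rl t) (x t)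

/-- The assumption on the human operator for the closed-loop motion `(R_l, x)` under
consideration. The reference `R_r` is constant and the operator is time invariant by typing. -/
structure HumanAssumption {n : ℕ} (H : HumanOperator n) (ks : ℝ) (Rr : Mat3)
    (Rl : ℝ → Mat3) (x : ℝ → EuclideanSpace ℝ (Fin n)) : Prop where
  posDef : ∀ t, 0 ≤ t → (Rrᵀ * Rl t + (Rrᵀ * Rl t)ᵀ).PosDef
  zero_command : ZeroCommandOnlyIfAligned H ks Rr
  bounded : BoundedResponse H Rr Rl x
  passive : PassiveResponse H Rr Rl x

end SemiAutonomous

/-! The proof is a LaSalle argument in the relative attitudes `A = Rrᵀ * Rbar` and `B = Rrᵀ * Rl`.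
Twice the integral of the passivity supply minus `tr A + tr B` has derivative `-(ks / 2) *
dissipation A B`, and passivity bounds it below, so it converges as soon as the dissipation is
nonnegative.

The dissipation is `tr ((A + B) N Nᵀ)` with `N = 1 - Aᵀ B`, so it is nonnegative when `A` and `B`
have semidefinite symmetric parts. For a rotation this means `1 ≤ tr A`, and that bound is invariant
for the average because `tr A` strictly increases whenever it equals 1 (`one_le_trace_avg`).

Bounded translates of the trajectory converge along any ultrafilter tending to infinity, and the
limit is again a closed-loop motion (`exists_limit`), now without dissipation. By
`eq_or_eq_transpose_of_dissipation` it satisfies `B = A` or `B = Aᵀ`. Then everything is at rest,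
the command is zero (`command_eq_zero`), and the operator assumption aligns the leader. Since `A`
and `Aᵀ` have the same fixed vectors, the average is aligned too. -/

namespace SemiAutonomous

/-! ### Rotations and Cayley–Hamilton -/

namespace IsRotation

theorem mul_transpose {R : Mat3} (h : IsRotation R) : R * Rᵀ = 1 :=
  (mem_orthogonalGroup_iff (Fin 3) ℝ).mp (mem_specialOrthogonalGroup_iff.mp h).1

theorem transpose_mul {R : Mat3} (h : IsRotation R) : Rᵀ * R = 1 :=
  (mem_orthogonalGroup_iff' (Fin 3) ℝ).mp (mem_specialOrthogonalGroup_iff.mp h).1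

theorem det_eq_one {R : Mat3} (h : IsRotation R) : R.det = 1 :=
  (mem_specialOrthogonalGroup_iff.mp h).2

theorem of_mul_transpose {R : Mat3} (h : R * Rᵀ = 1) (hd : R.det = 1) : IsRotation R :=
  mem_specialOrthogonalGroup_iff.mpr ⟨(mem_orthogonalGroup_iff (Fin 3) ℝ).mpr h, hd⟩

theorem transpose {R : Mat3} (h : IsRotation R) : IsRotation Rᵀ :=
  of_mul_transpose (by rw [transpose_transpose]; exact h.transpose_mul)
    (by rw [det_transpose]; exact h.det_eq_one)

theorem mul {R S : Mat3} (hR : IsRotation R) (hS : IsRotation S) : IsRotation (R * S) :=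
  mul_mem (S := Submonoid Mat3) hR hS

theorem adjugate_eq {R : Mat3} (h : IsRotation R) : R.adjugate = Rᵀ := by
  have h1 : Rᵀ * (R * R.adjugate) = Rᵀ := by rw [mul_adjugate, h.det_eq_one]; simp
  rwa [← Matrix.mul_assoc, h.transpose_mul, Matrix.one_mul] at h1

theorem abs_apply_le_one {R : Mat3} (h : IsRotation R) (i j : Fin 3) : |R i j| ≤ 1 := by
  have h1 := congrFun (congrFun h.mul_transpose i) i
  simp only [Matrix.mul_apply, transpose_apply, one_apply_eq] at h1
  have h2 : R i j * R i j ≤ ∑ k, R i k * R i k :=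
    Finset.single_le_sum (f := fun k => R i k * R i k) (fun k _ => mul_self_nonneg _)
      (Finset.mem_univ j)
  rw [h1] at h2
  exact abs_le_one_iff_mul_self_le_one.mpr h2

theorem trace_le_three {R : Mat3} (h : IsRotation R) : R.trace ≤ 3 := by
  rw [trace_fin_three]
  have := fun i => (abs_le.mp (h.abs_apply_le_one i i)).2
  linarith [this 0, this 1, this 2]

end IsRotation

/-- This is Cayley–Hamilton with one factor `A` cancelled; as a polynomial identity it needs no
invertibility. -/
theorem adjugate_eq_sq (A : Mat3) :
    A.adjugate = A * A - A.trace • A + A.adjugate.trace • (1 : Mat3) := by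
  rw [adjugate_fin_three]
  ext i j
  fin_cases i <;> fin_cases j <;>
    simp [Matrix.mul_apply, Fin.sum_univ_three, trace_fin_three] <;> ring

/-- The Cayley–Hamilton identity for rotations. -/
theorem IsRotation.sq_eq {A : Mat3} (h : IsRotation A) :
    A * A = A.trace • A - A.trace • (1 : Mat3) + Aᵀ := by
  have := adjugate_eq_sq A
  rw [h.adjugate_eq, trace_transpose] at this
  rw [this]; abel

/-! ### The hat map and the velocities in matrix form -/

theorem mul_hat_mul_transpose (M : Mat3) (w : Vec3) :
    M * hat w * Mᵀ = hat (M.adjugateᵀ *ᵥ w) := by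
  rw [adjugate_fin_three]
  ext i j
  fin_cases i <;> fin_cases j <;>
    simp [hat, Matrix.mul_apply, Fin.sum_univ_three, Matrix.mulVec, dotProduct] <;> ring

theorem IsRotation.hat_mulVec_mul {R : Mat3} (h : IsRotation R) (w : Vec3) :
    hat (R *ᵥ w) * R = R * hat w := by
  have := mul_hat_mul_transpose R w
  rw [h.adjugate_eq, transpose_transpose] at this
  rw [← this, Matrix.mul_assoc, h.transpose_mul, Matrix.mul_one]

theorem hat_add (v w : Vec3) : hat (v + w) = hat v + hat w := by
  ext i j; fin_cases i <;> fin_cases j <;> simp [hat] <;> ring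

theorem hat_smul (c : ℝ) (v : Vec3) : hat (c • v) = c • hat v := by
  ext i j; fin_cases i <;> fin_cases j <;> simp [hat]

theorem hat_injective : Function.Injective hat := Function.LeftInverse.injective vee_hat

/-- The average evolves by `R̄' = k_s R̄ sk(R̄ᵀ R_l)`. -/
theorem hat_averageVelocity_mul {ks : ℝ} {Rbar Rl : Mat3} (h : IsRotation Rbar) :
    hat (averageVelocity ks Rbar Rl) * Rbar =
      (ks / 2) • (Rl - Rbar * Rlᵀ * Rbar) := by
  rw [averageVelocity, hat_smul, Matrix.smul_mul, h.hat_mulVec_mul, hat_vee_sk, sk,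
    Matrix.mul_smul, smul_smul, Matrix.mul_sub, transpose_mul, transpose_transpose,
    ← Matrix.mul_assoc, h.mul_transpose, Matrix.one_mul, ← Matrix.mul_assoc]
  congr 1; ring

theorem mul_hat_leaderVelocity {n : ℕ} {H : HumanOperator n} {ks : ℝ} {Rr Rbar Rl : Mat3}
    {x : EuclideanSpace ℝ (Fin n)} (h : IsRotation Rl) :
    Rl * hat (leaderVelocity ks Rbar Rl (commandSpatial H Rr Rl x)) =
      (ks / 2) • (Rbar - Rl * Rbarᵀ * Rl) + Rl * hat (commandBody H Rr Rl x) := by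
  rw [leaderVelocity, commandSpatial, mulVec_mulVec, h.transpose_mul, one_mulVec, hat_add,
    hat_smul, hat_vee_sk, sk, Matrix.mul_add, Matrix.mul_smul, Matrix.mul_smul, smul_smul,
    Matrix.mul_sub, transpose_mul, transpose_transpose,
    ← Matrix.mul_assoc, h.mul_transpose, Matrix.one_mul, ← Matrix.mul_assoc]
  congr 2; ring

theorem trace_mul_hat (B : Mat3) (w : Vec3) :
    (B * hat w).trace = 2 * (vee (sk Bᵀ) ⬝ᵥ w) := by
  simp [trace_fin_three, hat, vee, sk, Matrix.mul_apply, Fin.sum_univ_three, dotProduct]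
  ring

/-! ### Symmetric parts and the angle of a rotation -/

/-- Since `N * Nᵀ` is symmetric, only the symmetric part of `C` contributes. All sign statements
about the dissipation rest on this. -/
theorem trace_mul_mul_transpose (C N : Mat3) :
    (C * (N * Nᵀ)).trace = (1 / 2) * (Nᵀ * (C + Cᵀ) * N).trace := by
  have h1 : (Nᵀ * C * N).trace = (C * (N * Nᵀ)).trace := by
    rw [trace_mul_comm, ← Matrix.mul_assoc, trace_mul_comm]
  have h2 : (Nᵀ * Cᵀ * N).trace = (C * (N * Nᵀ)).trace := by
    rw [← h1, ← trace_transpose]; simp [Matrix.mul_assoc]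
  rw [Matrix.mul_add, Matrix.add_mul, trace_add, h1, h2]; ring

theorem trace_mul_mul_transpose_nonneg {C : Mat3} (hC : (C + Cᵀ).PosSemidef) (N : Mat3) :
    0 ≤ (C * (N * Nᵀ)).trace := by
  rw [trace_mul_mul_transpose]
  have := (hC.conjTranspose_mul_mul_same N).trace_nonneg
  rw [conjTranspose_eq_transpose_of_trivial] at this
  linarith

theorem add_transpose_mul_eq_zero {C N : Mat3} (hC : (C + Cᵀ).PosSemidef)
    (h : (C * (N * Nᵀ)).trace = 0) : (C + Cᵀ) * N = 0 := by
  rw [trace_mul_mul_transpose] at h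
  have h0 := hC.conjTranspose_mul_mul_same N
  have h1 := h0.trace_eq_zero_iff.mp
  rw [conjTranspose_eq_transpose_of_trivial] at h1
  have h2 := h1 (by linarith)
  ext i j
  have h3 := (hC.dotProduct_mulVec_zero_iff (fun k => N k j)).mp (by
    have := congrFun (congrFun h2 j) j
    rw [Matrix.mul_assoc, Matrix.mul_apply] at this
    simpa [dotProduct, Matrix.mulVec, Matrix.mul_apply] using this)
  exact congrFun h3 i

theorem trace_mul_mul_transpose_pos {C N : Mat3} (hC : (C + Cᵀ).PosDef) (hN : N ≠ 0) :
    0 < (C * (N * Nᵀ)).trace := by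
  refine lt_of_le_of_ne (trace_mul_mul_transpose_nonneg hC.posSemidef N) fun h => hN ?_
  have h1 := add_transpose_mul_eq_zero hC.posSemidef h.symm
  have h2 := (Matrix.isUnit_iff_isUnit_det _).mp hC.isUnit
  have h3 : (C + Cᵀ)⁻¹ * ((C + Cᵀ) * N) = N := nonsing_inv_mul_cancel_left _ _ h2
  rw [h1, Matrix.mul_zero] at h3
  exact h3.symm

theorem one_sub_mul_transpose {A : Mat3} (h : IsRotation A) :
    (1 - A) * (1 - A)ᵀ = (2 : ℝ) • (1 : Mat3) - A - Aᵀ := by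
  rw [transpose_sub, transpose_one, Matrix.mul_sub, Matrix.sub_mul, Matrix.sub_mul,
    h.mul_transpose, two_smul]
  simp; abel

theorem IsRotation.transpose_mul_transpose {A : Mat3} (h : IsRotation A) :
    Aᵀ * Aᵀ = A.trace • Aᵀ - A.trace • (1 : Mat3) + A := by
  simpa [trace_transpose] using h.transpose.sq_eq

theorem IsRotation.eq_one_of_trace {A : Mat3} (h : IsRotation A) (ht : A.trace = 3) : A = 1 := by
  have h1 := one_sub_mul_transpose h
  have h2 : ((1 - A) * (1 - A)ᴴ).trace = 0 := by
    rw [conjTranspose_eq_transpose_of_trivial, h1]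
    simp [trace_sub, trace_smul, trace_transpose, ht]; norm_num
  exact (sub_eq_zero.mp (trace_mul_conjTranspose_self_eq_zero_iff.mp h2)).symm

/-- A rotation has positive semidefinite symmetric part only if its angle is at most `π/2`. -/
theorem IsRotation.one_le_trace {A : Mat3} (h : IsRotation A) (hA : (A + Aᵀ).PosSemidef) :
    1 ≤ A.trace := by
  -- With `τ = A.trace`, Cayley–Hamilton turns this trace into `(τ - 1) * (3 - τ)`.
  have h1 := trace_mul_mul_transpose_nonneg hA (1 - A)
  rw [one_sub_mul_transpose h, Matrix.mul_sub, Matrix.mul_sub, h.mul_transpose, h.sq_eq] at h1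
  simp only [Matrix.mul_smul, Matrix.mul_one, trace_sub, trace_add, trace_smul, trace_transpose,
    trace_one, Fintype.card_fin, smul_eq_mul] at h1
  norm_num at h1
  rcases eq_or_lt_of_le h.trace_le_three with h3 | h3
  · linarith
  · nlinarith

/-- A rotation has positive semidefinite symmetric part if its angle is at most `π/2`. -/
theorem IsRotation.posSemidef_of_one_le_trace {A : Mat3} (h : IsRotation A) (ht : 1 ≤ A.trace) :
    (A + Aᵀ).PosSemidef := by
  rcases eq_or_lt_of_le h.trace_le_three with h3 | h3
  · rw [h.eq_one_of_trace h3, transpose_one]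
    exact PosSemidef.one.add PosSemidef.one
  -- For axis `n` and angle `θ`, `A + Aᵀ = 2 cos θ • 1 + 2 (1 - cos θ) • n nᵀ` and `A.trace - 1 = 2
  -- cos θ`. So `M` is a multiple of the projection onto the axis, which `hsq` expresses without
  -- choosing `n`.
  · set M : Mat3 := A + Aᵀ - (A.trace - 1) • (1 : Mat3) with hM
    have hMt : Mᵀ = M := by rw [hM]; simp [add_comm]
    have hsq : M * M = (3 - A.trace) • M := by
      have e1 := h.sq_eq
      have e2 := h.transpose_mul_transpose
      rw [hM]
      simp only [Matrix.mul_sub, Matrix.sub_mul, Matrix.mul_add, Matrix.add_mul, Matrix.mul_smul,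
        Matrix.smul_mul, Matrix.mul_one, Matrix.one_mul, h.mul_transpose, h.transpose_mul, e1, e2]
      module
    have hpsd : M.PosSemidef := by
      have h4 := (posSemidef_conjTranspose_mul_self M).smul
        (inv_nonneg.mpr (sub_nonneg.mpr h3.le))
      rwa [conjTranspose_eq_transpose_of_trivial, hMt, hsq, smul_smul,
        inv_mul_cancel₀ (by linarith), one_smul] at h4
    have : A + Aᵀ = M + (A.trace - 1) • (1 : Mat3) := by rw [hM]; abel
    rw [this]
    exact hpsd.add (PosSemidef.one.smul (by linarith))

/-! ### Dissipation and its zeros -/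

/-- The dissipation rate of the synchronization law. -/
noncomputable def dissipation (A B : Mat3) : ℝ :=
  ((A + B) * ((1 - Aᵀ * B) * (1 - Aᵀ * B)ᵀ)).trace

theorem dissipation_eq {A B : Mat3} (hA : IsRotation A) (hB : IsRotation B) :
    dissipation A B =
      (B - A * Bᵀ * A).trace + (A - B * Aᵀ * B).trace := by
  rw [dissipation, one_sub_mul_transpose (hA.transpose.mul hB), ← trace_add]
  congr 1
  simp only [transpose_mul, transpose_transpose, Matrix.mul_sub, Matrix.add_mul, Matrix.mul_smul,
    Matrix.mul_one, ← Matrix.mul_assoc, hA.mul_transpose, hB.mul_transpose, Matrix.one_mul]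
  module

theorem dissipation_nonneg {A B : Mat3} (hA : (A + Aᵀ).PosSemidef) (hB : (B + Bᵀ).PosSemidef) :
    0 ≤ dissipation A B := by
  rw [dissipation, Matrix.add_mul, trace_add]
  exact add_nonneg (trace_mul_mul_transpose_nonneg hA _) (trace_mul_mul_transpose_nonneg hB _)

/-- At trace 1, Cayley–Hamilton gives `1 - Aᵀ * Aᵀ = (1 - A) * (1 - A)ᵀ`. The left side of the
inequality is the growth rate of `A.trace` up to the factor `ks / 2`, so the average cannot cross
the angle `π/2`. -/
theorem IsRotation.trace_sub_pos {A B : Mat3} (hA : IsRotation A) (hB : (B + Bᵀ).PosDef)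
    (ht : A.trace = 1) : 0 < (B - A * Bᵀ * A).trace := by
  have h1 : (A * Bᵀ * A).trace = (B * (Aᵀ * Aᵀ)).trace := by
    rw [← trace_transpose (A * Bᵀ * A), Matrix.transpose_mul, Matrix.transpose_mul,
      transpose_transpose, trace_mul_comm, Matrix.mul_assoc]
  have h2 : (B - A * Bᵀ * A).trace = (B * ((1 - A) * (1 - A)ᵀ)).trace := by
    rw [trace_sub, h1, ← trace_sub, one_sub_mul_transpose hA, hA.transpose_mul_transpose, ht]
    congr 1
    simp only [Matrix.mul_sub, Matrix.mul_add, Matrix.mul_smul, Matrix.mul_one]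
    module
  rw [h2]
  refine trace_mul_mul_transpose_pos hB fun h0 => ?_
  rw [← sub_eq_zero.mp h0] at ht
  simp at ht

/-- On the columns of `N` one has `A² = -1` and `Aᵀ = -A`, so Cayley–Hamilton reads `(A.trace - 1) •
(N - A * N) = 0`. If the trace is not 1, then `A` fixes `N`, contradicting `A² = -1` there. -/
theorem IsRotation.trace_eq_one {A N : Mat3} (h : IsRotation A) (hN : (A + Aᵀ) * N = 0)
    (hN0 : N ≠ 0) : A.trace = 1 := by
  by_contra ht
  have h1 : A * (A * N) = -N := by
    have : A * ((A + Aᵀ) * N) = 0 := by rw [hN, Matrix.mul_zero]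
    rw [Matrix.add_mul, Matrix.mul_add, ← Matrix.mul_assoc A Aᵀ, h.mul_transpose,
      Matrix.one_mul] at this
    exact eq_neg_of_add_eq_zero_left this
  have h2 : Aᵀ * N = -(A * N) := by
    rw [Matrix.add_mul] at hN
    exact eq_neg_of_add_eq_zero_right hN
  have h3 : (A.trace - 1) • (N - A * N) = 0 := by
    have := congrArg (· * N) h.sq_eq
    simp only [Matrix.add_mul, Matrix.sub_mul, Matrix.smul_mul, Matrix.one_mul, h2,
      Matrix.mul_assoc, h1] at this
    rw [← sub_eq_zero] at this
    rw [← this]; module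
  have h4 : A * N = N := by
    rcases smul_eq_zero.mp h3 with h | h
    · exact absurd (sub_eq_zero.mp h) ht
    · exact (sub_eq_zero.mp h).symm
  rw [h4, h4] at h1
  refine hN0 ?_
  ext i j
  have h5 : N i j = -N i j := congrFun (congrFun h1 i) j
  change N i j = 0
  linarith

/-- The square of `hat a` is `a aᵀ - |a|² • 1`, so it determines every product `a i * a j`, and
these determine `a` up to sign. -/
theorem eq_or_eq_neg_of_hat_sq {a b : Vec3} (h : hat a * hat a = hat b * hat b) :
    a = b ∨ a = -b := by
  have e := fun i j => congrFun (congrFun h i) j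
  have e00 := e 0 0
  have e11 := e 1 1
  have e22 := e 2 2
  have e01 := e 0 1
  have e02 := e 0 2
  have e12 := e 1 2
  simp [hat, Matrix.mul_apply, Fin.sum_univ_three] at e00 e11 e22 e01 e02 e12
  have key : ∀ i j, a i * a j = b i * b j := by
    intro i j; fin_cases i <;> fin_cases j <;> simp <;> linarith
  by_cases ha : a = 0
  · left
    ext i
    have := key i i
    simp only [ha, Pi.zero_apply, mul_zero] at this ⊢
    exact (mul_self_eq_zero.mp this.symm).symm
  · obtain ⟨i, hi⟩ := Function.ne_iff.mp ha
    simp only [Pi.zero_apply] at hi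
    rcases mul_self_eq_mul_self_iff.mp (key i i) with h1 | h1
    · left; ext j
      have := key i j
      rw [h1] at this hi
      exact mul_left_cancel₀ hi this
    · right; ext j
      have := key i j
      rw [h1] at this hi
      simp only [Pi.neg_apply]
      exact mul_left_cancel₀ hi (by linarith)

/-- The synchronization law dissipates nothing only for equal or mutually inverse rotations. -/
theorem eq_or_eq_transpose_of_dissipation {A B : Mat3} (hA : IsRotation A) (hB : IsRotation B)
    (pA : (A + Aᵀ).PosSemidef) (pB : (B + Bᵀ).PosSemidef) (h : dissipation A B = 0) :
    B = A ∨ B = Aᵀ ∧ A.trace = 1 := by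
  set N : Mat3 := 1 - Aᵀ * B with hN
  have hnA := trace_mul_mul_transpose_nonneg pA N
  have hnB := trace_mul_mul_transpose_nonneg pB N
  rw [dissipation, Matrix.add_mul, trace_add, ← hN] at h
  have zA := add_transpose_mul_eq_zero pA (by linarith : (A * (N * Nᵀ)).trace = 0)
  have zB := add_transpose_mul_eq_zero pB (by linarith : (B * (N * Nᵀ)).trace = 0)
  by_cases hN0 : N = 0
  · left
    have h1 : A * N = A - B := by
      rw [hN, Matrix.mul_sub, Matrix.mul_one, ← Matrix.mul_assoc, hA.mul_transpose,
        Matrix.one_mul]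
    rw [hN0, Matrix.mul_zero] at h1
    exact (sub_eq_zero.mp h1.symm).symm
  have tA := hA.trace_eq_one zA hN0
  have tB := hB.trace_eq_one zB hN0
  have sA := hA.sq_eq
  have sB := hB.sq_eq
  have sA' := hA.transpose_mul_transpose
  have sB' := hB.transpose_mul_transpose
  rw [tA, one_smul, one_smul] at sA sA'
  rw [tB, one_smul, one_smul] at sB sB'
  -- At trace 1, `A + Aᵀ` is twice the projection onto the axis of `A`. Thus `a1` and `b1` say that
  -- each rotation fixes the axis of the other.
  have a1 : (A + Aᵀ) * B = A + Aᵀ := by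
    rw [hN, Matrix.mul_sub, Matrix.mul_one, ← Matrix.mul_assoc, Matrix.add_mul A Aᵀ Aᵀ,
      hA.mul_transpose, sA', sub_eq_zero] at zA
    have : 1 + (Aᵀ - 1 + A) = A + Aᵀ := by abel
    rw [this] at zA
    exact zA.symm
  have b1 : A * (B + Bᵀ) = B + Bᵀ := by
    rw [hN, Matrix.mul_sub, Matrix.mul_one, sub_eq_zero] at zB
    have h1 := congrArg Matrix.transpose zB
    simp only [transpose_mul, transpose_add, transpose_transpose] at h1
    have h2 : B * (Bᵀ + B) = Bᵀ + B := by
      rw [Matrix.mul_add, hB.mul_transpose, sB]; abel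
    rw [add_comm Bᵀ B, Matrix.mul_assoc] at h1
    rw [add_comm Bᵀ B, h1, ← Matrix.mul_assoc, hB.mul_transpose, Matrix.one_mul, ← h1] at h2
    exact h2
  have a2 : (A + Aᵀ) * Bᵀ = A + Aᵀ := by
    have := congrArg (· * Bᵀ) a1
    simp only [Matrix.mul_assoc, hB.mul_transpose, Matrix.mul_one] at this
    exact this.symm
  have b2 : Aᵀ * (B + Bᵀ) = B + Bᵀ := by
    have := congrArg (Aᵀ * ·) b1
    simp only [← Matrix.mul_assoc, hA.transpose_mul, Matrix.one_mul] at this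
    exact this.symm
  -- The product of the two symmetric parts, evaluated in two ways.
  have hP : A + Aᵀ = B + Bᵀ := by
    have h1 : (A + Aᵀ) * (B + Bᵀ) = (2 : ℝ) • (A + Aᵀ) := by
      rw [Matrix.mul_add, a1, a2, two_smul]
    have h2 : (A + Aᵀ) * (B + Bᵀ) = (2 : ℝ) • (B + Bᵀ) := by
      rw [Matrix.add_mul, b1, b2, two_smul]
    exact smul_right_injective _ (two_ne_zero (α := ℝ)) (h1.symm.trans h2)
  -- The symmetric part determines the square of the skew part, so only a sign remains free; it
  -- separates `A` from `Aᵀ`.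
  have hs : ∀ C : Mat3, IsRotation C → C.trace = 1 →
      sk C * sk C = (1 / 2 : ℝ) • (C + Cᵀ) - (1 : Mat3) := by
    intro C hC tC
    have s := hC.sq_eq
    have s' := hC.transpose_mul_transpose
    rw [tC, one_smul, one_smul] at s s'
    rw [sk, Matrix.smul_mul, Matrix.mul_smul, Matrix.mul_sub, Matrix.sub_mul, Matrix.sub_mul, s, s',
      hC.mul_transpose, hC.transpose_mul]
    module
  have h1 : hat (vee (sk A)) * hat (vee (sk A)) = hat (vee (sk B)) * hat (vee (sk B)) := by
    rw [hat_vee_sk, hat_vee_sk, hs A hA tA, hs B hB tB, hP]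
  have dec : ∀ C : Mat3, C = (1 / 2 : ℝ) • (C + Cᵀ) + sk C := fun C => by rw [sk]; module
  rcases eq_or_eq_neg_of_hat_sq h1 with h2 | h2
  · left
    have := congrArg hat h2
    rw [hat_vee_sk, hat_vee_sk] at this
    rw [dec A, dec B, this, hP]
  · right
    refine ⟨?_, tA⟩
    have := congrArg hat h2
    rw [← neg_one_smul ℝ, hat_smul, hat_vee_sk, hat_vee_sk] at this
    rw [dec B, ← hP]
    have h3 : sk B = (-1 : ℝ) • sk A := by rw [this]; module
    rw [h3, sk]; module

/-- Zero dissipation concerns only the sum of two traces; here both matrices vanish, hence both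
synchronization velocities. -/
theorem sub_mul_transpose_mul_eq_zero {A B : Mat3} (hA : IsRotation A)
    (h : B = A ∨ B = Aᵀ ∧ A.trace = 1) : B - A * Bᵀ * A = 0 ∧ A - B * Aᵀ * B = 0 := by
  rcases h with rfl | ⟨rfl, tA⟩
  · simp [hA.mul_transpose]
  · have s := hA.sq_eq
    have s' := hA.transpose_mul_transpose
    rw [tA, one_smul, one_smul] at s s'
    simp only [transpose_transpose, s, s', Matrix.add_mul, Matrix.sub_mul, Matrix.one_mul,
      hA.mul_transpose, hA.transpose_mul]
    constructor <;> abel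

/-! ### Limits of translates along ultrafilters -/

section TranslateLimits

variable {E : Type*} [NormedAddCommGroup E] [NormedSpace ℝ E]

/-- Translates of a bounded curve with bounded velocity converge, locally uniformly, along every
ultrafilter that tends to infinity. -/
theorem exists_translate_limit [ProperSpace E] (𝒰 : Ultrafilter ℝ) (h𝒰 : (𝒰 : Filter ℝ) ≤ atTop)
    {h h' : ℝ → E} {C D : ℝ} (hd : ∀ t, 0 ≤ t → HasDerivWithinAt h (h' t) (Ici 0) t)
    (hC : ∀ t, 0 ≤ t → ‖h' t‖ ≤ C) (hD : ∀ t, 0 ≤ t → ‖h t‖ ≤ D) :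
    ∃ G : ℝ → E, Continuous G ∧
      ∀ s, Tendsto (fun p : ℝ × ℝ => h (p.1 + p.2)) ((𝒰 : Filter ℝ) ×ˢ 𝓝 s) (𝓝 (G s)) := by
  have hlip : ∀ a b, 0 ≤ a → 0 ≤ b → ‖h b - h a‖ ≤ C * ‖b - a‖ := fun a b ha hb =>
    (convex_Ici (0 : ℝ)).norm_image_sub_le_of_norm_hasDerivWithin_le (fun t ht => hd t ht)
      (fun t ht => hC t ht) ha hb
  have hev : ∀ s : ℝ, ∀ᶠ τ in (𝒰 : Filter ℝ), 0 ≤ τ + s := fun s =>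
    h𝒰 ((eventually_ge_atTop (-s)).mono fun τ hτ => by linarith)
  -- The ultrafilter gives limits for all `s` at once, with no extraction of subsequences. The
  -- Lipschitz bound then upgrades them to convergence along `𝒰 ×ˢ 𝓝 s`, that is, locally uniformly.
  have hex : ∀ s : ℝ, ∃ g, Tendsto (fun τ => h (τ + s)) 𝒰 (𝓝 g) := by
    intro s
    obtain ⟨g, -, hg⟩ := (isCompact_closedBall (0 : E) D).ultrafilter_le_nhds
      (𝒰.map fun τ => h (τ + s)) (by
        rw [le_principal_iff]
        exact (hev s).mono fun τ hτ => mem_closedBall_zero_iff.mpr (hD _ hτ))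
    exact ⟨g, hg⟩
  choose G hG using hex
  have hGlip : ∀ a b, ‖G b - G a‖ ≤ C * ‖b - a‖ := by
    intro a b
    refine le_of_tendsto ((hG b).sub (hG a)).norm ?_
    filter_upwards [hev a, hev b] with τ ha hb
    simpa using hlip _ _ ha hb
  have hlim : ∀ s : ℝ, Tendsto (fun y : ℝ => C * ‖y - s‖) (𝓝 s) (𝓝 0) := fun s => by
    have : Continuous fun y : ℝ => C * ‖y - s‖ := by fun_prop
    simpa using this.tendsto s
  refine ⟨G, continuous_iff_continuousAt.mpr fun s => ?_, fun s => ?_⟩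
  · exact tendsto_iff_norm_sub_tendsto_zero.mpr
      (squeeze_zero (fun _ => norm_nonneg _) (fun y => hGlip s y) (hlim s))
  · have h1 : Tendsto (fun p : ℝ × ℝ => h (p.1 + s)) ((𝒰 : Filter ℝ) ×ˢ 𝓝 s) (𝓝 (G s)) :=
      (hG s).comp tendsto_fst
    have h2 : Tendsto (fun p : ℝ × ℝ => h (p.1 + p.2) - h (p.1 + s))
        ((𝒰 : Filter ℝ) ×ˢ 𝓝 s) (𝓝 0) := by
      refine squeeze_zero_norm' ?_ ((hlim s).comp tendsto_snd)
      have e1 := (hev (s - 1)).prod_mk (Ioi_mem_nhds (sub_one_lt s))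
      filter_upwards [e1] with p hp
      have hp2 : s - 1 < p.2 := hp.2
      have := hlip (p.1 + s) (p.1 + p.2) (by linarith [hp.1]) (by linarith [hp.1])
      simpa using this
    simpa using h2.add h1

/-- A limit of translates is differentiable if the velocities converge. -/
theorem hasDerivAt_translate_limit {l : Filter ℝ} [l.NeBot] (hl : l ≤ atTop)
    {h h' G G' : ℝ → E} (hd : ∀ t, 0 ≤ t → HasDerivWithinAt h (h' t) (Ici 0) t)
    (hG : ∀ s, Tendsto (fun p : ℝ × ℝ => h (p.1 + p.2)) (l ×ˢ 𝓝 s) (𝓝 (G s)))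
    (hG' : ∀ s, Tendsto (fun p : ℝ × ℝ => h' (p.1 + p.2)) (l ×ˢ 𝓝 s) (𝓝 (G' s)))
    (hc : Continuous G') (s : ℝ) : HasDerivAt G (G' s) s := by
  refine hasDerivAt_of_tendstoUniformlyOnFilter (l := l) (f := fun τ y => h (τ + y))
    (f' := fun τ y => h' (τ + y)) ?_ ?_ ?_
  · rw [tendstoUniformlyOnFilter_iff_tendsto]
    have h1 : Tendsto (fun p : ℝ × ℝ => G' p.2) (l ×ˢ 𝓝 s) (𝓝 (G' s)) :=
      (hc.tendsto s).comp tendsto_snd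
    exact (h1.prodMk_nhds (hG' s)).mono_right (nhds_le_uniformity _)
  · have e1 : ∀ᶠ τ in l, 0 ≤ τ + (s - 1) :=
      hl ((eventually_ge_atTop (1 - s)).mono fun τ hτ => by linarith)
    filter_upwards [e1.prod_mk (Ioi_mem_nhds (sub_one_lt s))] with p hp
    have hp1 := hp.1
    have hp2 : s - 1 < p.2 := hp.2
    have hpos : 0 < p.1 + p.2 := by linarith
    exact ((hd _ hpos.le).hasDerivAt (Ici_mem_nhds hpos)).comp_const_add p.1 p.2
  · exact Eventually.of_forall fun y =>
      (hG y).comp (tendsto_id.prodMk (tendsto_const_nhds (x := y)))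

/-- A limit of translates of a motion of `h' = Φ(ζ)` satisfies the same equation. -/
theorem hasDerivAt_translate_limit_comp {X : Type*} [TopologicalSpace X] {l : Filter ℝ} [l.NeBot]
    (hl : l ≤ atTop) {ζ z : ℝ → X} (hz : Continuous z)
    (hζ : ∀ s, Tendsto (fun p : ℝ × ℝ => ζ (p.1 + p.2)) (l ×ˢ 𝓝 s) (𝓝 (z s)))
    {Φ : X → E} (hΦ : Continuous Φ) {h G : ℝ → E}
    (hd : ∀ t, 0 ≤ t → HasDerivWithinAt h (Φ (ζ t)) (Ici 0) t)
    (hG : ∀ s, Tendsto (fun p : ℝ × ℝ => h (p.1 + p.2)) (l ×ˢ 𝓝 s) (𝓝 (G s))) (s : ℝ) :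
    HasDerivAt G (Φ (z s)) s :=
  hasDerivAt_translate_limit hl hd hG (G' := fun s => Φ (z s))
    (fun s => (hΦ.tendsto (z s)).comp (hζ s)) (hΦ.comp hz) s

end TranslateLimits

/-! ### Closedness and continuity -/

theorem isClosed_setOf_isRotation : IsClosed {R : Mat3 | IsRotation R} := by
  have : {R : Mat3 | IsRotation R} = {R | R * Rᵀ = 1} ∩ {R | R.det = 1} := by
    ext R
    exact ⟨fun h => ⟨h.mul_transpose, h.det_eq_one⟩, fun h => .of_mul_transpose h.1 h.2⟩
  rw [this]
  exact (isClosed_eq (by fun_prop) continuous_const).inter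
    (isClosed_eq (by fun_prop) continuous_const)

/-- Positive definiteness may be lost in a limit, so limit motions are handled with semidefinite
symmetric parts only. -/
theorem isClosed_setOf_posSemidef : IsClosed {M : Mat3 | M.PosSemidef} := by
  have : {M : Mat3 | M.PosSemidef} =
      {M | Mᴴ = M} ∩ ⋂ v : Vec3, {M | 0 ≤ star v ⬝ᵥ M *ᵥ v} := by
    ext M
    simp [posSemidef_iff_dotProduct_mulVec, IsHermitian]
  rw [this]
  refine (isClosed_eq (by fun_prop) continuous_id).inter (isClosed_iInter fun v => ?_)
  exact isClosed_le continuous_const (by fun_prop)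

theorem continuous_hat : Continuous hat := by
  refine continuous_matrix fun i j => ?_
  fin_cases i <;> fin_cases j <;> simp [hat] <;> fun_prop

theorem continuous_vee : Continuous vee := by
  refine continuous_pi fun i => ?_
  fin_cases i <;> simp [vee] <;> fun_prop

theorem continuous_sk : Continuous sk := by
  unfold sk; fun_prop

theorem continuous_zAxis : Continuous zAxis := by
  unfold zAxis; fun_prop

theorem continuous_dissipation : Continuous fun p : Mat3 × Mat3 => dissipation p.1 p.2 := by
  unfold dissipation; fun_prop

/-! ### The closed loop and its limit motions -/

section ClosedLoop

variable {n : ℕ} (H : HumanOperator n) (ks : ℝ) (Rr : Mat3)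

/-- The states `(R̄, R_l, x)` of the closed loop. -/
abbrev State (n : ℕ) := Mat3 × Mat3 × EuclideanSpace ℝ (Fin n)

theorem continuous_humanInput : Continuous (humanInput Rr) := by
  unfold humanInput
  exact continuous_vee.comp (continuous_sk.comp (by fun_prop))

theorem continuous_commandBody :
    Continuous fun z : State n => commandBody H Rr z.2.1 z.2.2 := by
  unfold commandBody
  exact H.continuous_g.comp (f := fun z : State n => (z.2.2, humanInput Rr z.2.1))
    (continuous_snd.snd.prodMk ((continuous_humanInput Rr).comp continuous_snd.fst))

theorem continuous_velocity_avg :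
    Continuous fun z : State n => hat (averageVelocity ks z.1 z.2.1) * z.1 := by
  have h1 : Continuous fun z : State n => vee (sk (z.1ᵀ * z.2.1)) :=
    continuous_vee.comp (continuous_sk.comp (by fun_prop))
  have h2 : Continuous fun z : State n => averageVelocity ks z.1 z.2.1 := by
    unfold averageVelocity; fun_prop
  exact (continuous_hat.comp h2).matrix_mul continuous_fst

theorem continuous_velocity_leader : Continuous fun z : State n =>
    z.2.1 * hat (leaderVelocity ks z.1 z.2.1 (commandSpatial H Rr z.2.1 z.2.2)) := by
  have h0 := continuous_commandBody H Rr
  have h1 : Continuous fun z : State n => vee (sk (z.2.1ᵀ * z.1)) :=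
    continuous_vee.comp (continuous_sk.comp (by fun_prop))
  have h2 : Continuous fun z : State n =>
      leaderVelocity ks z.1 z.2.1 (commandSpatial H Rr z.2.1 z.2.2) := by
    unfold leaderVelocity commandSpatial; fun_prop
  exact continuous_snd.fst.matrix_mul (continuous_hat.comp h2)

theorem continuous_velocity_state :
    Continuous fun z : State n => H.f z.2.2 (humanInput Rr z.2.1) :=
  H.continuous_f.comp (f := fun z : State n => (z.2.2, humanInput Rr z.2.1))
    (continuous_snd.snd.prodMk ((continuous_humanInput Rr).comp continuous_snd.fst))

/-- A compact set of states that holds all rotations and all `x` of norm at most `D`. -/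
def stateBox (n : ℕ) (D : ℝ) : Set (State n) :=
  (univ.pi fun _ : Fin 3 => univ.pi fun _ : Fin 3 => Icc (-1 : ℝ) 1) ×ˢ
    ((univ.pi fun _ : Fin 3 => univ.pi fun _ : Fin 3 => Icc (-1 : ℝ) 1) ×ˢ
      Metric.closedBall 0 D)

theorem isCompact_stateBox (D : ℝ) : IsCompact (stateBox n D) := by
  have h : IsCompact (univ.pi fun _ : Fin 3 => univ.pi fun _ : Fin 3 => Icc (-1 : ℝ) 1) :=
    isCompact_univ_pi fun _ => isCompact_univ_pi fun _ => isCompact_Icc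
  exact h.prod (h.prod (isCompact_closedBall 0 D))

variable {H ks Rr} {Rbar Rl : ℝ → Mat3} {x : ℝ → EuclideanSpace ℝ (Fin n)}

namespace IsTrajectory

theorem mem_stateBox (htraj : IsTrajectory H ks Rr Rbar Rl x) {D : ℝ}
    (hD : ∀ t, 0 ≤ t → ‖x t‖ ≤ D) {t : ℝ} (ht : 0 ≤ t) :
    (Rbar t, Rl t, x t) ∈ stateBox n D :=
  ⟨fun i _ j _ => abs_le.mp ((htraj.rotation_avg t ht).abs_apply_le_one i j),
    fun i _ j _ => abs_le.mp ((htraj.rotation_leader t ht).abs_apply_le_one i j),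
    mem_closedBall_zero_iff.mpr (hD t ht)⟩

/-- A bounded motion of the closed loop has limit motions: its translates converge along every
ultrafilter that tends to infinity, and the limit is a motion of the closed loop. -/
theorem exists_limit (htraj : IsTrajectory H ks Rr Rbar Rl x) {D : ℝ}
    (hD : ∀ t, 0 ≤ t → ‖x t‖ ≤ D) (𝒰 : Ultrafilter ℝ) (h𝒰 : (𝒰 : Filter ℝ) ≤ atTop) :
    ∃ z : ℝ → State n, Continuous z ∧
      (∀ s, Tendsto (fun p : ℝ × ℝ => (Rbar (p.1 + p.2), Rl (p.1 + p.2), x (p.1 + p.2)))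
        ((𝒰 : Filter ℝ) ×ˢ 𝓝 s) (𝓝 (z s))) ∧
      IsTrajectory H ks Rr (fun s => (z s).1) (fun s => (z s).2.1) (fun s => (z s).2.2) := by
  set ζ : ℝ → State n := fun t => (Rbar t, Rl t, x t)
  have bdd : ∀ {F : Type} [NormedAddCommGroup F] {Φ : State n → F}, Continuous Φ →
      ∃ C, ∀ t, 0 ≤ t → ‖Φ (ζ t)‖ ≤ C := fun hΦ =>
    let ⟨C, hC⟩ := (isCompact_stateBox D).exists_bound_of_continuousOn hΦ.continuousOn
    ⟨C, fun t ht => hC _ (htraj.mem_stateBox hD ht)⟩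
  have cA := fun i j => (continuous_velocity_avg (n := n) ks).matrix_elem i j
  have cB := fun i j => (continuous_velocity_leader H ks Rr).matrix_elem i j
  have cX := continuous_velocity_state H Rr
  have eA : ∀ i j, ∃ G : ℝ → ℝ, Continuous G ∧
      ∀ s, Tendsto (fun p : ℝ × ℝ => Rbar (p.1 + p.2) i j) ((𝒰 : Filter ℝ) ×ˢ 𝓝 s)
        (𝓝 (G s)) := fun i j => by
    obtain ⟨C, hC⟩ := bdd (cA i j)
    exact exists_translate_limit 𝒰 h𝒰 (fun t ht => htraj.deriv_avg t ht i j) hC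
      (fun t ht => (htraj.rotation_avg t ht).abs_apply_le_one i j)
  have eB : ∀ i j, ∃ G : ℝ → ℝ, Continuous G ∧
      ∀ s, Tendsto (fun p : ℝ × ℝ => Rl (p.1 + p.2) i j) ((𝒰 : Filter ℝ) ×ˢ 𝓝 s)
        (𝓝 (G s)) := fun i j => by
    obtain ⟨C, hC⟩ := bdd (cB i j)
    exact exists_translate_limit 𝒰 h𝒰 (fun t ht => htraj.deriv_leader t ht i j) hC
      (fun t ht => (htraj.rotation_leader t ht).abs_apply_le_one i j)
  obtain ⟨C, hC⟩ := bdd cX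
  obtain ⟨X, hXc, hX⟩ := exists_translate_limit 𝒰 h𝒰 htraj.deriv_state hC hD
  choose A hAc hA using eA
  choose B hBc hB using eB
  set z : ℝ → State n := fun s => (Matrix.of fun i j => A i j s, Matrix.of fun i j => B i j s, X s)
    with hz
  have hzc : Continuous z :=
    (continuous_matrix fun i j => hAc i j).prodMk
      ((continuous_matrix fun i j => hBc i j).prodMk hXc)
  have hlim : ∀ s, Tendsto (fun p : ℝ × ℝ => ζ (p.1 + p.2)) ((𝒰 : Filter ℝ) ×ˢ 𝓝 s) (𝓝 (z s)) :=
    fun s =>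
    (tendsto_pi_nhds.mpr fun i => tendsto_pi_nhds.mpr fun j => hA i j s).prodMk_nhds
      ((tendsto_pi_nhds.mpr fun i => tendsto_pi_nhds.mpr fun j => hB i j s).prodMk_nhds (hX s))
  have hpt : ∀ s, Tendsto (fun τ => (Rbar (τ + s), Rl (τ + s), x (τ + s))) 𝒰 (𝓝 (z s)) :=
    fun s => (hlim s).comp (tendsto_id.prodMk (tendsto_const_nhds (x := s)))
  have hev : ∀ s : ℝ, ∀ᶠ τ in (𝒰 : Filter ℝ), 0 ≤ τ + s := fun s =>
    h𝒰 ((eventually_ge_atTop (-s)).mono fun τ hτ => by linarith)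
  refine ⟨z, hzc, hlim, fun t _ => ?_, fun t _ => ?_, fun t _ i j => ?_, fun t _ i j => ?_,
    fun t _ => ?_⟩
  · exact isClosed_setOf_isRotation.mem_of_tendsto (hpt t).fst_nhds
      ((hev t).mono fun τ hτ => htraj.rotation_avg _ hτ)
  · exact isClosed_setOf_isRotation.mem_of_tendsto (hpt t).snd_nhds.fst_nhds
      ((hev t).mono fun τ hτ => htraj.rotation_leader _ hτ)
  · exact (hasDerivAt_translate_limit_comp h𝒰 hzc (ζ := ζ) hlim (cA i j)
      (fun t ht => htraj.deriv_avg t ht i j) (hA i j) t).hasDerivWithinAt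
  · exact (hasDerivAt_translate_limit_comp h𝒰 hzc (ζ := ζ) hlim (cB i j)
      (fun t ht => htraj.deriv_leader t ht i j) (hB i j) t).hasDerivWithinAt
  · exact (hasDerivAt_translate_limit_comp h𝒰 hzc (ζ := ζ) hlim cX htraj.deriv_state hX
      t).hasDerivWithinAt

theorem continuousOn_state (htraj : IsTrajectory H ks Rr Rbar Rl x) :
    ContinuousOn (fun t => ((Rbar t, Rl t, x t) : State n)) (Ici 0) := by
  refine ContinuousOn.prodMk ?_ (ContinuousOn.prodMk ?_ ?_)
  · exact continuousOn_pi.mpr fun i => continuousOn_pi.mpr fun j t ht =>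
      (htraj.deriv_avg t ht i j).continuousWithinAt
  · exact continuousOn_pi.mpr fun i => continuousOn_pi.mpr fun j t ht =>
      (htraj.deriv_leader t ht i j).continuousWithinAt
  · exact fun t ht => (htraj.deriv_state t ht).continuousWithinAt

end IsTrajectory

/-! ### Invariance, energy and motions without dissipation -/

theorem hasDerivWithinAt_trace_mul {R : ℝ → Mat3} {R' M : Mat3} {s : Set ℝ} {t : ℝ}
    (h : ∀ i j, HasDerivWithinAt (fun s => R s i j) (R' i j) s t) :
    HasDerivWithinAt (fun s => (M * R s).trace) (M * R').trace s t := by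
  simp only [trace, diag_apply, Matrix.mul_apply]
  exact HasDerivWithinAt.fun_sum fun i _ => HasDerivWithinAt.fun_sum fun j _ =>
    (h j i).const_mul (M i j)

theorem transpose_mul_sub (hRr : IsRotation Rr) (P Q : Mat3) :
    Rrᵀ * (Q - P * Qᵀ * P) = Rrᵀ * Q - Rrᵀ * P * (Rrᵀ * Q)ᵀ * (Rrᵀ * P) := by
  simp only [Matrix.transpose_mul, transpose_transpose, Matrix.mul_sub, Matrix.mul_assoc]
  rw [← Matrix.mul_assoc Rr Rrᵀ, hRr.mul_transpose, Matrix.one_mul]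

namespace IsTrajectory

theorem hasDerivWithinAt_trace_avg (htraj : IsTrajectory H ks Rr Rbar Rl x)
    (hRr : IsRotation Rr) {t : ℝ} (ht : 0 ≤ t) :
    HasDerivWithinAt (fun s => (Rrᵀ * Rbar s).trace)
      (ks / 2 * (Rrᵀ * Rl t - Rrᵀ * Rbar t * (Rrᵀ * Rl t)ᵀ * (Rrᵀ * Rbar t)).trace)
      (Ici 0) t := by
  have := hasDerivWithinAt_trace_mul (M := Rrᵀ) (htraj.deriv_avg t ht)
  rwa [hat_averageVelocity_mul (htraj.rotation_avg t ht), Matrix.mul_smul, trace_smul,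
    smul_eq_mul, transpose_mul_sub hRr] at this

theorem hasDerivWithinAt_trace_leader (htraj : IsTrajectory H ks Rr Rbar Rl x)
    (hRr : IsRotation Rr) {t : ℝ} (ht : 0 ≤ t) :
    HasDerivWithinAt (fun s => (Rrᵀ * Rl s).trace)
      (ks / 2 * (Rrᵀ * Rbar t - Rrᵀ * Rl t * (Rrᵀ * Rbar t)ᵀ * (Rrᵀ * Rl t)).trace +
        2 * (humanInput Rr (Rl t) ⬝ᵥ commandBody H Rr (Rl t) (x t)))
      (Ici 0) t := by
  have := hasDerivWithinAt_trace_mul (M := Rrᵀ) (htraj.deriv_leader t ht)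
  rwa [mul_hat_leaderVelocity (htraj.rotation_leader t ht), Matrix.mul_add, Matrix.mul_smul,
    trace_add, trace_smul, smul_eq_mul, transpose_mul_sub hRr, ← Matrix.mul_assoc Rrᵀ _ (hat _),
    trace_mul_hat, Matrix.transpose_mul Rrᵀ (Rl t), transpose_transpose] at this

/-- The average stays within the angle `π/2` of the reference. -/
theorem one_le_trace_avg (htraj : IsTrajectory H ks Rr Rbar Rl x) (hks : 0 < ks)
    (hRr : IsRotation Rr) (hpd : ∀ t, 0 ≤ t → (Rrᵀ * Rl t + (Rrᵀ * Rl t)ᵀ).PosDef)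
    (hinit : (Rrᵀ * Rbar 0 + (Rrᵀ * Rbar 0)ᵀ).PosSemidef) {t : ℝ} (ht : 0 ≤ t) :
    1 ≤ (Rrᵀ * Rbar t).trace := by
  have hrot := fun t ht => hRr.transpose.mul (htraj.rotation_avg t ht)
  have hd := fun t ht => (htraj.hasDerivWithinAt_trace_avg hRr (t := t) ht).neg
  -- Barrier argument: the sign of the derivative matters only at times when the trace equals 1.
  have := image_le_of_deriv_right_lt_deriv_boundary (a := 0) (b := t)
    (f := fun s => -(Rrᵀ * Rbar s).trace) (B := fun _ => (-1 : ℝ)) (B' := fun _ => 0)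
    (fun s hs => (hd s hs.1).continuousWithinAt.mono Icc_subset_Ici_self)
    (fun s hs => (hd s hs.1).mono (Ici_subset_Ici.mpr hs.1))
    (neg_le_neg ((hrot 0 le_rfl).one_le_trace hinit))
    (fun s => hasDerivAt_const s _)
    (fun s hs he => neg_lt_zero.mpr (mul_pos (by linarith)
      ((hrot s hs.1).trace_sub_pos (hpd s hs.1) (neg_injective he))))
    (right_mem_Icc.mpr ht)
  linarith

/-- The stored energy plus the energy fed back by the human converges, and it decreases at the
dissipation rate. -/
theorem exists_energy (htraj : IsTrajectory H ks Rr Rbar Rl x) (hks : 0 < ks)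
    (hRr : IsRotation Rr) (hpass : PassiveResponse H Rr Rl x)
    (hA : ∀ t, 0 ≤ t → (Rrᵀ * Rbar t + (Rrᵀ * Rbar t)ᵀ).PosSemidef)
    (hB : ∀ t, 0 ≤ t → (Rrᵀ * Rl t + (Rrᵀ * Rl t)ᵀ).PosSemidef) :
    ∃ (U : ℝ → ℝ) (c : ℝ), Tendsto U atTop (𝓝 c) ∧ ∀ t, 0 ≤ t →
      HasDerivWithinAt U (-(ks / 2 * dissipation (Rrᵀ * Rbar t) (Rrᵀ * Rl t))) (Ici 0) t := by
  obtain ⟨β, -, hβ⟩ := hpass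
  set p : ℝ → ℝ := fun t => humanInput Rr (Rl t) ⬝ᵥ commandBody H Rr (Rl t) (x t) with hp
  have hpc : ContinuousOn p (Ici 0) := by
    have h1 : Continuous fun z : State n =>
        humanInput Rr z.2.1 ⬝ᵥ commandBody H Rr z.2.1 z.2.2 :=
      ((continuous_humanInput Rr).comp continuous_snd.fst).dotProduct (continuous_commandBody H Rr)
    exact Continuous.comp_continuousOn (f := fun t => ((Rbar t, Rl t, x t) : State n)) h1
      htraj.continuousOn_state
  -- Freezing `p` for negative times makes it continuous on the whole line, so its integral is
  -- differentiable at 0 too.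
  set q : ℝ → ℝ := fun t => p (max t 0) with hq
  have hqc : Continuous q :=
    hpc.comp_continuous (by fun_prop) fun t => le_max_right t 0
  have hI : ∀ τ, 0 ≤ τ → ∫ t in (0 : ℝ)..τ, q t = ∫ t in (0 : ℝ)..τ, p t := fun τ hτ =>
    intervalIntegral.integral_congr fun t ht => by
      rw [uIcc_of_le hτ] at ht
      simp only [hq, max_eq_left ht.1]
  set U : ℝ → ℝ := fun t =>
    2 * (∫ s in (0 : ℝ)..t, q s) - (Rrᵀ * Rbar t).trace - (Rrᵀ * Rl t).trace with hU
  have hd : ∀ t, 0 ≤ t → HasDerivWithinAt U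
      (-(ks / 2 * dissipation (Rrᵀ * Rbar t) (Rrᵀ * Rl t))) (Ici 0) t := by
    intro t ht
    have h1 : HasDerivAt (fun u => ∫ s in (0 : ℝ)..u, q s) (q t) t :=
      intervalIntegral.integral_hasDerivAt_right (hqc.intervalIntegrable _ _)
        (hqc.stronglyMeasurableAtFilter _ _) hqc.continuousAt
    have hqt : q t = p t := by simp only [hq, max_eq_left ht]
    have h2 := ((h1.hasDerivWithinAt.const_mul 2).sub
      (htraj.hasDerivWithinAt_trace_avg hRr ht)).sub (htraj.hasDerivWithinAt_trace_leader hRr ht)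
    refine h2.congr_deriv ?_
    rw [dissipation_eq (hRr.transpose.mul (htraj.rotation_avg t ht))
      (hRr.transpose.mul (htraj.rotation_leader t ht)), hqt]
    ring
  have hanti : AntitoneOn U (Ici 0) := by
    refine antitoneOn_of_deriv_nonpos (convex_Ici 0)
      (fun t ht => (hd t ht).continuousWithinAt) ?_ ?_
    · intro t ht
      exact ((hd t (interior_subset ht)).mono interior_subset).differentiableWithinAt
    · intro t ht
      rw [interior_Ici] at ht
      have ht' : 0 < t := ht
      rw [((hd t ht'.le).hasDerivAt (Ici_mem_nhds ht')).deriv]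
      exact neg_nonpos.mpr
        (mul_nonneg (by linarith) (dissipation_nonneg (hA t ht'.le) (hB t ht'.le)))
  have hmono : Antitone fun t => U (max t 0) := fun a b hab =>
    hanti (le_max_right a 0) (le_max_right b 0) (max_le_max_right 0 hab)
  have hbdd : BddBelow (range fun t => U (max t 0)) := by
    -- The supply contributes at least `-2β`, and each of the two traces is at most 3.
    refine ⟨-(2 * β) - 6, ?_⟩
    rintro _ ⟨t, rfl⟩
    have ht := le_max_right t 0
    have h1 := hβ _ ht
    rw [← hI _ ht] at h1
    have h2 := (hRr.transpose.mul (htraj.rotation_avg _ ht)).trace_le_three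
    have h3 := (hRr.transpose.mul (htraj.rotation_leader _ ht)).trace_le_three
    simp only [hU]
    linarith
  refine ⟨U, _, (tendsto_atTop_ciInf hmono hbdd).congr' ?_, hd⟩
  filter_upwards [eventually_ge_atTop 0] with t ht
  rw [max_eq_left ht]

/-- On a motion without dissipation the average and the leader are at rest, and the human sends
zero. -/
theorem command_eq_zero (htraj : IsTrajectory H ks Rr Rbar Rl x) (hRr : IsRotation Rr)
    (hA : ∀ t, 0 ≤ t → (Rrᵀ * Rbar t + (Rrᵀ * Rbar t)ᵀ).PosSemidef)
    (hB : ∀ t, 0 ≤ t → (Rrᵀ * Rl t + (Rrᵀ * Rl t)ᵀ).PosSemidef)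
    (hdiss : ∀ t, 0 ≤ t → dissipation (Rrᵀ * Rbar t) (Rrᵀ * Rl t) = 0) {t : ℝ} (ht : 0 ≤ t) :
    commandSpatial H Rr (Rl t) (x t) = 0 := by
  have rA := fun t ht => hRr.transpose.mul (htraj.rotation_avg t ht)
  have rB := fun t ht => hRr.transpose.mul (htraj.rotation_leader t ht)
  have hcase := fun t ht =>
    eq_or_eq_transpose_of_dissipation (rA t ht) (rB t ht) (hA t ht) (hB t ht) (hdiss t ht)
  have hcancel : ∀ M : Mat3, Rrᵀ * M = 0 → M = 0 := fun M h => by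
    have := congrArg (Rr * ·) h
    simpa only [← Matrix.mul_assoc, hRr.mul_transpose, Matrix.one_mul, Matrix.mul_zero] using this
  have hzero : ∀ t, 0 ≤ t → Rl t - Rbar t * (Rl t)ᵀ * Rbar t = 0 ∧
      Rbar t - Rl t * (Rbar t)ᵀ * Rl t = 0 := fun t ht => by
    have := sub_mul_transpose_mul_eq_zero (rA t ht) (hcase t ht)
    rw [← transpose_mul_sub hRr, ← transpose_mul_sub hRr] at this
    exact ⟨hcancel _ this.1, hcancel _ this.2⟩
  have hconstA : ∀ t, 0 ≤ t → Rbar t = Rbar 0 := by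
    intro t ht
    ext i j
    have h1 := (convex_Ici (0 : ℝ)).norm_image_sub_le_of_norm_hasDerivWithin_le (C := 0)
      (fun s hs => htraj.deriv_avg s hs i j) (fun s hs => by
        rw [hat_averageVelocity_mul (htraj.rotation_avg s hs), (hzero s hs).1]; simp)
      (self_mem_Ici (a := (0 : ℝ))) ht
    rw [zero_mul] at h1
    exact sub_eq_zero.mp (norm_le_zero_iff.mp h1)
  -- With the average at rest, the leader moves continuously in a set of at most two points, so it
  -- cannot switch between them.
  have hmem : MapsTo (fun t => Rrᵀ * Rl t) (Ici 0)
      {Rrᵀ * Rbar 0, (Rrᵀ * Rbar 0)ᵀ} := by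
    intro t ht
    have := hcase t ht
    rw [hconstA t ht] at this
    exact this.imp id And.left
  have hcont : ContinuousOn (fun t => Rrᵀ * Rl t) (Ici 0) := by
    have h1 : Continuous fun z : State n => Rrᵀ * z.2.1 := by fun_prop
    exact h1.comp_continuousOn htraj.continuousOn_state
  have hconstB : ∀ s, 0 ≤ s → Rl s = Rl t := fun s hs => by
    have := isPreconnected_Ici.constant_of_mapsTo (Set.toFinite _).isDiscrete hcont hmem hs ht
    change Rrᵀ * Rl s = Rrᵀ * Rl t at this
    rw [← sub_eq_zero, ← Matrix.mul_sub] at this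
    exact sub_eq_zero.mp (hcancel _ this)
  have hvel : Rl t * hat (leaderVelocity ks (Rbar t) (Rl t)
      (commandSpatial H Rr (Rl t) (x t))) = 0 := by
    ext i j
    have h1 : HasDerivWithinAt (fun s => Rl s i j) 0 (Ici 0) t :=
      (hasDerivWithinAt_const t (Ici 0) (Rl t i j)).congr (fun s hs => by rw [hconstB s hs]) rfl
    exact (uniqueDiffOn_Ici (0 : ℝ) t ht).eq_deriv _ (htraj.deriv_leader t ht i j) h1
  -- The leader is at rest and its synchronization term vanishes, so the command is all that is left
  -- of its velocity.
  rw [mul_hat_leaderVelocity (htraj.rotation_leader t ht), (hzero t ht).2, smul_zero,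
    zero_add] at hvel
  have h2 : hat (commandBody H Rr (Rl t) (x t)) = 0 := by
    have := congrArg ((Rl t)ᵀ * ·) hvel
    simpa only [← Matrix.mul_assoc, (htraj.rotation_leader t ht).transpose_mul, Matrix.one_mul,
      Matrix.mul_zero] using this
  have h3 : hat (0 : Vec3) = 0 := by
    ext i j; fin_cases i <;> fin_cases j <;> simp [hat]
  rw [commandSpatial, hat_injective (h2.trans h3.symm), mulVec_zero]

end IsTrajectory

/-- A rotation and its inverse fix the same vectors, so the alternative `B = Aᵀ` does no harm to the
`z`-axes. -/
theorem zAxis_eq_of_eq_or_eq_transpose {P Q : Mat3} (hRr : IsRotation Rr) (hP : IsRotation P)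
    (h : Rrᵀ * Q = Rrᵀ * P ∨ Rrᵀ * Q = (Rrᵀ * P)ᵀ) (hQ : zAxis Q = zAxis Rr) :
    zAxis P = zAxis Rr := by
  have hA := hRr.transpose.mul hP
  have h1 : (Rrᵀ * Q) *ᵥ ![0, 0, 1] = ![0, 0, 1] := by
    have := congrArg (Rrᵀ *ᵥ ·) hQ
    simpa only [zAxis, mulVec_mulVec, hRr.transpose_mul, one_mulVec] using this
  have h2 : (Rrᵀ * P) *ᵥ ![0, 0, 1] = ![0, 0, 1] := by
    rcases h with h | h
    · rwa [← h]
    · rw [h] at h1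
      have := congrArg ((Rrᵀ * P) *ᵥ ·) h1
      simp only [mulVec_mulVec, hA.mul_transpose, one_mulVec] at this
      exact this.symm
  have := congrArg (Rr *ᵥ ·) h2
  simpa only [zAxis, mulVec_mulVec, ← Matrix.mul_assoc, hRr.mul_transpose, Matrix.one_mul]
    using this

end ClosedLoop

end SemiAutonomous

/-! ### Convergence of the `z`-axes -/

theorem mainTheorem1 {n : ℕ} (H : SemiAutonomous.HumanOperator n) (ks : ℝ) (hks : 0 < ks)
    (Rr : SemiAutonomous.Mat3) (hRr : SemiAutonomous.IsRotation Rr)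
    (Rbar Rl : ℝ → SemiAutonomous.Mat3) (x : ℝ → EuclideanSpace ℝ (Fin n))
    (htraj : SemiAutonomous.IsTrajectory H ks Rr Rbar Rl x)
    (hhuman : SemiAutonomous.HumanAssumption H ks Rr Rl x)
    (hinit : (Rrᵀ * Rbar 0 + (Rrᵀ * Rbar 0)ᵀ).PosSemidef) :
    Tendsto (fun t => SemiAutonomous.zAxis (Rbar t)) atTop (𝓝 (SemiAutonomous.zAxis Rr)) ∧
    Tendsto (fun t => SemiAutonomous.zAxis (Rl t)) atTop (𝓝 (SemiAutonomous.zAxis Rr)) := by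
  open SemiAutonomous in
  have hB := fun t ht => (hhuman.posDef t ht).posSemidef
  have hA : ∀ t, 0 ≤ t → (Rrᵀ * Rbar t + (Rrᵀ * Rbar t)ᵀ).PosSemidef := fun t ht =>
    (hRr.transpose.mul (htraj.rotation_avg t ht)).posSemidef_of_one_le_trace
      (htraj.one_le_trace_avg hks hRr hhuman.posDef hinit ht)
  have hinput : Bornology.IsBounded ((fun t => humanInput Rr (Rl t)) '' Ici 0) := by
    have h1 : IsCompact (univ.pi fun _ : Fin 3 => univ.pi fun _ : Fin 3 => Icc (-1 : ℝ) 1) :=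
      isCompact_univ_pi fun _ => isCompact_univ_pi fun _ => isCompact_Icc
    refine (h1.image (continuous_humanInput Rr)).isBounded.subset ?_
    rintro _ ⟨t, ht, rfl⟩
    exact ⟨Rl t, fun i _ j _ => abs_le.mp ((htraj.rotation_leader t ht).abs_apply_le_one i j), rfl⟩
  obtain ⟨D, hD⟩ := (hhuman.bounded hinput).2.exists_norm_le
  have hD' : ∀ t, 0 ≤ t → ‖x t‖ ≤ D := fun t ht => hD _ (mem_image_of_mem x ht)
  obtain ⟨U, c, hU, hUd⟩ := htraj.exists_energy hks hRr hhuman.passive hA hB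
  suffices h : ∀ 𝒰 : Ultrafilter ℝ, (𝒰 : Filter ℝ) ≤ atTop →
      Tendsto (fun t => zAxis (Rbar t)) 𝒰 (𝓝 (zAxis Rr)) ∧
      Tendsto (fun t => zAxis (Rl t)) 𝒰 (𝓝 (zAxis Rr)) from
    ⟨(tendsto_iff_ultrafilter _ _ _).mpr fun 𝒰 h𝒰 => (h 𝒰 h𝒰).1,
      (tendsto_iff_ultrafilter _ _ _).mpr fun 𝒰 h𝒰 => (h 𝒰 h𝒰).2⟩
  intro 𝒰 h𝒰
  obtain ⟨z, hzc, hlim, hz⟩ := htraj.exists_limit hD' 𝒰 h𝒰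
  have hpt : ∀ s, Tendsto (fun τ => (Rbar (τ + s), Rl (τ + s), x (τ + s))) 𝒰 (𝓝 (z s)) :=
    fun s => (hlim s).comp (tendsto_id.prodMk (tendsto_const_nhds (x := s)))
  have hev : ∀ s : ℝ, ∀ᶠ τ in (𝒰 : Filter ℝ), 0 ≤ τ + s := fun s =>
    h𝒰 ((eventually_ge_atTop (-s)).mono fun τ hτ => by linarith)
  have hcl : IsClosed {M : Mat3 | (Rrᵀ * M + (Rrᵀ * M)ᵀ).PosSemidef} :=
    isClosed_setOf_posSemidef.preimage (by fun_prop)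
  have hA' : ∀ t, 0 ≤ t → (Rrᵀ * (z t).1 + (Rrᵀ * (z t).1)ᵀ).PosSemidef := fun t _ =>
    hcl.mem_of_tendsto (hpt t).fst_nhds ((hev t).mono fun τ hτ => hA _ hτ)
  have hB' : ∀ t, 0 ≤ t → (Rrᵀ * (z t).2.1 + (Rrᵀ * (z t).2.1)ᵀ).PosSemidef := fun t _ =>
    hcl.mem_of_tendsto (hpt t).snd_nhds.fst_nhds ((hev t).mono fun τ hτ => hB _ hτ)
  have hdiss : ∀ t, 0 ≤ t → dissipation (Rrᵀ * (z t).1) (Rrᵀ * (z t).2.1) = 0 := by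
    intro t _
    have hc : Continuous fun y : State n =>
        -(ks / 2 * dissipation (Rrᵀ * y.1) (Rrᵀ * y.2.1)) := by
      have : Continuous fun y : State n => dissipation (Rrᵀ * y.1) (Rrᵀ * y.2.1) :=
        continuous_dissipation.comp (f := fun y : State n => (Rrᵀ * y.1, Rrᵀ * y.2.1))
          (by fun_prop)
      fun_prop
    have hGc : ∀ s : ℝ, Tendsto (fun p : ℝ × ℝ => U (p.1 + p.2)) ((𝒰 : Filter ℝ) ×ˢ 𝓝 s)
        (𝓝 c) := fun s =>
      hU.comp ((tendsto_fst.mono_right h𝒰).atTop_add tendsto_snd)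
    -- The translates of `U` converge to the constant `c`, whose derivative must be the limit of the
    -- dissipation rates; this replaces Barbalat's lemma.
    have h1 := hasDerivAt_translate_limit_comp h𝒰 hzc
      (ζ := fun t => (Rbar t, Rl t, x t)) hlim hc hUd (G := fun _ => c) hGc t
    have h2 := h1.unique (hasDerivAt_const t c)
    have h3 : ks / 2 ≠ 0 := by positivity
    exact (mul_eq_zero.mp (neg_eq_zero.mp h2)).resolve_left h3
  -- The operator assumption is applied to the limit motion, not to the given trajectory. Only time
  -- 0 is needed, since `z 0` is the limit of the trajectory itself along `𝒰`.
  have haxis : zAxis (z 0).2.1 = zAxis Rr :=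
    hhuman.zero_command _ _ _ hz hB' (fun t ht => hz.command_eq_zero hRr hA' hB' hdiss ht) 0 le_rfl
  have hcase := eq_or_eq_transpose_of_dissipation
    (hRr.transpose.mul (hz.rotation_avg 0 le_rfl)) (hRr.transpose.mul (hz.rotation_leader 0 le_rfl))
    (hA' 0 le_rfl) (hB' 0 le_rfl) (hdiss 0 le_rfl)
  have haxis' : zAxis (z 0).1 = zAxis Rr :=
    zAxis_eq_of_eq_or_eq_transpose hRr (hz.rotation_avg 0 le_rfl) (hcase.imp id And.left) haxis
  have h0 := hpt 0
  simp only [add_zero] at h0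
  rw [← haxis']
  refine ⟨(continuous_zAxis.tendsto _).comp h0.fst_nhds, ?_⟩
  rw [haxis', ← haxis]
  exact (continuous_zAxis.tendsto _).comp h0.snd_nhds.fst_nhds
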